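/- Setting. For a sequence of problems indexed by $k\in\mathbb N$ (the index is suppressed) let $n_L\le n$ and $T$ be positive integers with $n_L\to\infty$, $n\to\infty$, $T\to\infty$. The nodes are $1,\dots,n$ and the hub set is $\{1,\dots,n_L\}$. In the asymmetric hub model with parameter matrix $A\in[0,1]^{n_L\times n}$, $A_{ii}=1$ for $i=1,\dots,n_L$, there is a random vector $z_*=(z_*^{(1)},\dots,z_*^{(T)})\in\{1,\dots,n_L\}^T$ of latent hub labels (its law is arbitrary) and, conditionally on $z_*$, the group memberships $G_j^{(t)}\in\{0,1\}$ ($t=1,\dots,T$, $j=1,\dots,n$) are independent with $\mathbb P(G_j^{(t)}=1\mid z_*)=A_{z_*^{(t)},j}$. For a labelling $z\in\{1,\dots,n_L\}^T$ put $t_i=\sum_t 1(z^{(t)}=i)$, $\hat A^z_{ij}=\sum_t G_j^{(t)}1(z^{(t)}=i)/t_i$ (and $\hat A^z_{ij}=0$ if $t_i=0$), and, with $0\log 0=0$, $$L_G(z)=\sum_{t=1}^T\sum_{j=1}^n G_j^{(t)}\log \hat A^z_{z^{(t)},j}+(1-G_j^{(t)})\log(1-\hat A^z_{z^{(t)},j}).$$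 Let $\hat z$ be, almost surely, a maximizer (any one) of $L_G$ over the feasible labellings, i.e. those with $G^{(t)}_{z^{(t)}}=1$ for all $t$ (since $A_{ii}=1$, every other labelling has likelihood $0$). Let $T_e=\sum_t 1(z_*^{(t)}\ne\hat z^{(t)})$. Theorem. Assume that there are constants $c_{\min},s_{\min},\tau_0,c_0>0$ and $c_{\max},s_{\max}<\infty$, not depending on $k$, and numbers $d>0$, $v>0$, $s_{ij}$ (which may depend on $k$) such that: - ($H_1$) with probability tending to one (in particular, if this holds surely), $Tc_{\min}/n_L\le t_{i*}\le Tc_{\max}/n_L$ for all $i=1,\dots,n_L$, where $t_{i*}=\sum_t1(z_*^{(t)}=i)$; - ($H_2$) $A_{ij}=s_{ij}d$ with $s_{\min}\le s_{ij}\le s_{\max}$ for $i=1,\dots,n_L$, $j=1,\dots,n$, $j\ne i$, and $d\to0$; - ($H_3$) for each $i=1,\dots,n_L$ there is a set $V_i\subset\{n_L+1,\dots,n\}$ with $|V_i|\ge vn/n_L$, such that $s_{ij}-s_{i'j}\ge\tau_0$ for all $i\neq i'$ in $\{1,\dots,n_L\}$ and $j\in V_i$; - ($H_4$) $A_{ii'}\le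 c_0/n_L$ for all $i\ne i'$ in $\{1,\dots,n_L\}$. If $$\frac{n_L^2\log T}{dTv}\to0,\qquad \frac{(\log d)^2n_L^2\log n_L}{dnv^2}\to0,\qquad \frac{(\log T)^2n_L^2\log n_L}{dnv^2}\to0,$$ then $T_e/T=o_p(1)$, that is, $\mathbb P(T_e/T\ge\varepsilon)\to0$ for every $\varepsilon>0$. -/

import Mathlib

namespace HubModel

open MeasureTheory Filter Topology

/-- Probability that a Bernoulli variable with success probability `p` takes the value `g`. -/
noncomputable def bernoulliMass (p : ℝ) (g : Bool) : ℝ := if g then p else 1 - p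

/-- The parameter matrix `A` of the asymmetric hub model: nodes are `Fin n`, the hub set consists of
the first `nL` nodes (hub `i` is the node `Fin.castLE h i`), entries are probabilities and a hub
always belongs to the groups that it forms. -/
structure IsHubMatrix {nL n : ℕ} (h : nL ≤ n) (A : Fin nL → Fin n → ℝ) : Prop where
  nonneg : ∀ i j, 0 ≤ A i j
  le_one : ∀ i j, A i j ≤ 1
  hub : ∀ i, A i (Fin.castLE h i) = 1

/-- `T` groups from the asymmetric hub model with parameter matrix `A`: `zstar ω t` is the latent hub
of group `t`, `G ω t j = true` iff node `j` belongs to group `t`. Conditionally on the vector of hub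
labels (whose law is arbitrary) the memberships are independent and `G ω t j` is
Bernoulli with parameter `A (zstar ω t) j`. -/
structure IsHubModel {Ω : Type*} [MeasurableSpace Ω] (μ : Measure Ω) {nL n T : ℕ}
    (A : Fin nL → Fin n → ℝ)
    (zstar : Ω → Fin T → Fin nL) (G : Ω → Fin T → Fin n → Bool) : Prop where
  measurable_zstar : Measurable zstar
  measurable_G : Measurable G
  law : ∀ (z : Fin T → Fin nL) (g : Fin T → Fin n → Bool),
    μ.real {ω | zstar ω = z ∧ G ω = g} =
      μ.real {ω | zstar ω = z} * ∏ t, ∏ j, bernoulliMass (A (z t) j) (g t j)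

/-- `t_i`, the number of groups with hub label `i`. -/
def hubCount {nL T : ℕ} (z : Fin T → Fin nL) (i : Fin nL) : ℕ :=
  (Finset.univ.filter fun t => z t = i).card

/-- The indicator `G_j^{(t)}` as a real number. -/
noncomputable def ind (b : Bool) : ℝ := if b then 1 else 0

/-- The maximum likelihood estimator of `A` given the hub labels `z`; it is `0` when `t_i = 0`
(division by zero gives zero). -/
noncomputable def hatA {nL n T : ℕ} (G : Fin T → Fin n → Bool) (z : Fin T → Fin nL)
    (i : Fin nL) (j : Fin n) : ℝ :=
  (∑ t, ind (G t j) * (if z t = i then 1 else 0)) / (hubCount z i : ℝ)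

/-- The profile log-likelihood `L_G(z)`. The convention `0 * log 0 = 0` holds automatically. -/
noncomputable def profileLogLik {nL n T : ℕ} (G : Fin T → Fin n → Bool)
    (z : Fin T → Fin nL) : ℝ :=
  ∑ t, ∑ j, (ind (G t j) * Real.log (hatA G z (z t) j)
    + (1 - ind (G t j)) * Real.log (1 - hatA G z (z t) j))

/-- A labelling is feasible if the hub of every group belongs to the group. Because `A i i = 1` is
part of the model, the likelihood of every other labelling is zero for every parameter matrix. -/
def Feasible {nL n T : ℕ} (h : nL ≤ n) (G : Fin T → Fin n → Bool) (z : Fin T → Fin nL) : Prop :=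
  ∀ t, G t (Fin.castLE h (z t)) = true

/-- `zhat` is a maximum profile likelihood labelling for the data `G`. -/
def IsMaxProfileLik {nL n T : ℕ} (h : nL ≤ n) (G : Fin T → Fin n → Bool)
    (zhat : Fin T → Fin nL) : Prop :=
  Feasible h G zhat ∧ ∀ z, Feasible h G z → profileLogLik G z ≤ profileLogLik G zhat

/-- `T_e`, the number of mislabelled groups (no label swapping allowed). -/
def numErrors {nL T : ℕ} (zstar zhat : Fin T → Fin nL) : ℕ :=
  (Finset.univ.filter fun t => zstar t ≠ zhat t).card

/-- `X k = o_p(1)` for real random variables on probability spaces that may vary with `k`. -/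
def IsLittleOp {Ω : ℕ → Type*} [∀ k, MeasurableSpace (Ω k)] (μ : ∀ k, Measure (Ω k))
    (X : ∀ k, Ω k → ℝ) : Prop :=
  ∀ ε : ℝ, 0 < ε → Tendsto (fun k => μ k {ω | ε ≤ |X k ω|}) atTop (𝓝 0)

end HubModel

/-! Condition on the true labels. A feasible labelling `z` that beats the truth in profile
likelihood also has a fitted array whose likelihood is at least that of the true array
(`arrayMass_le_of_profileLogLik_le`). For one fixed competing array this has probability at most
exp(-H/2), where H sums (√P - √Q)² over all entries (`sum_arrayMass_le_of_likelihood_ratio`). A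
fitted array is determined by labels and integer counts, so a union bound over at most nL^T
(T+1)^(nL n) arrays applies.

The followers separate the rows of `A` in Hellinger distance, so each fitted row `i'` is close to at
most one true row, called `π i'`. Every group with true label other than `π (z t)` adds to H, so few
such groups survive the union bound. The other errors have true label `π (z t) ≠ z t`, a relabelling
that the likelihood alone does not exclude. Feasibility does: hub `z t` must then belong to a group
formed by another hub, which is rare. A Chernoff bound, united over the nL^nL maps `π`, controls
these memberships. Both bounds are combined in `sum_hasBadLabelling_le`, and `failure_bound_le`
compares entropies with exponents. -/

namespace HubModel

open Finset MeasureTheory Filter Topology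

/-! ### Independent Bernoulli arrays: likelihood comparison and counting bounds -/

/-- The probability of the membership array `g` if its entries are independent and `g t j` is
Bernoulli with parameter `P t j`. -/
noncomputable def arrayMass {T n : ℕ} (P : Fin T → Fin n → ℝ) (g : Fin T → Fin n → Bool) : ℝ :=
  ∏ t, ∏ j, bernoulliMass (P t j) (g t j)

lemma bernoulliMass_nonneg {p : ℝ} (h0 : 0 ≤ p) (h1 : p ≤ 1) (b : Bool) :
    0 ≤ bernoulliMass p b := by
  unfold bernoulliMass; split_ifs <;> linarith

lemma arrayMass_nonneg {T n : ℕ} {P : Fin T → Fin n → ℝ} (h0 : ∀ t j, 0 ≤ P t j)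
    (h1 : ∀ t j, P t j ≤ 1) (g : Fin T → Fin n → Bool) : 0 ≤ arrayMass P g :=
  prod_nonneg fun t _ => prod_nonneg fun j _ => bernoulliMass_nonneg (h0 t j) (h1 t j) _

lemma sum_array_prod {T n : ℕ} (f : Fin T → Fin n → Bool → ℝ) :
    ∑ g : Fin T → Fin n → Bool, ∏ t, ∏ j, f t j (g t j) = ∏ t, ∏ j, (f t j true + f t j false) := by
  have h1 : ∀ t, ∏ j, (f t j true + f t j false) = ∑ r : Fin n → Bool, ∏ j, f t j (r j) := by
    intro t
    have := Finset.prod_univ_sum (fun _ : Fin n => (univ : Finset Bool)) (fun j b => f t j b)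
    simpa only [Fintype.piFinset_univ, Fintype.sum_bool] using this
  simp_rw [h1]
  have := Finset.prod_univ_sum (fun _ : Fin T => (univ : Finset (Fin n → Bool)))
    (fun t r => ∏ j, f t j (r j))
  simpa [Fintype.piFinset_univ] using this.symm

/-- The Hellinger affinity of two Bernoulli laws. -/
lemma bernoulli_affinity_le {p q : ℝ} (hp0 : 0 ≤ p) (hp1 : p ≤ 1) (hq0 : 0 ≤ q) (hq1 : q ≤ 1) :
    √p * √q + √(1 - p) * √(1 - q) ≤ Real.exp (-((√p - √q) ^ 2 / 2)) := by
  -- The affinity is 1 - ½[(√p - √q)² + (√(1-p) - √(1-q))²]; the second square is dropped.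
  have h := Real.add_one_le_exp (-((√p - √q) ^ 2 / 2))
  nlinarith [Real.sq_sqrt hp0, Real.sq_sqrt hq0, Real.sq_sqrt (sub_nonneg.2 hp1),
    Real.sq_sqrt (sub_nonneg.2 hq1), sq_nonneg (√(1 - p) - √(1 - q))]

/-- The probability that the likelihood of `Q` is at least the likelihood of the true `P`. -/
lemma sum_arrayMass_le_of_likelihood_ratio {T n : ℕ} {P Q : Fin T → Fin n → ℝ}
    (hP0 : ∀ t j, 0 ≤ P t j) (hP1 : ∀ t j, P t j ≤ 1)
    (hQ0 : ∀ t j, 0 ≤ Q t j) (hQ1 : ∀ t j, Q t j ≤ 1) :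
    ∑ g, (if arrayMass P g ≤ arrayMass Q g then arrayMass P g else 0)
      ≤ Real.exp (-((∑ t, ∑ j, (√(P t j) - √(Q t j)) ^ 2) / 2)) := by
  -- On the event P ≤ Q one has P ≤ √P √Q, and the sum of √P √Q over all arrays factors into
  -- entrywise affinities.
  have key : ∀ g, (if arrayMass P g ≤ arrayMass Q g then arrayMass P g else 0)
      ≤ ∏ t, ∏ j, (√(bernoulliMass (P t j) (g t j)) * √(bernoulliMass (Q t j) (g t j))) := by
    intro g
    have hp := arrayMass_nonneg hP0 hP1 g
    have hq := arrayMass_nonneg hQ0 hQ1 g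
    have e : ∏ t, ∏ j, (√(bernoulliMass (P t j) (g t j)) * √(bernoulliMass (Q t j) (g t j)))
        = √(arrayMass P g) * √(arrayMass Q g) := by
      unfold arrayMass
      rw [Real.sqrt_prod, Real.sqrt_prod, ← prod_mul_distrib]
      · refine prod_congr rfl fun t _ => ?_
        rw [Real.sqrt_prod, Real.sqrt_prod, ← prod_mul_distrib]
        · exact fun j _ => bernoulliMass_nonneg (hQ0 t j) (hQ1 t j) _
        · exact fun j _ => bernoulliMass_nonneg (hP0 t j) (hP1 t j) _
      · exact fun t _ => prod_nonneg fun j _ => bernoulliMass_nonneg (hQ0 t j) (hQ1 t j) _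
      · exact fun t _ => prod_nonneg fun j _ => bernoulliMass_nonneg (hP0 t j) (hP1 t j) _
    rw [e]
    split_ifs with h
    · calc arrayMass P g = √(arrayMass P g) * √(arrayMass P g) := (Real.mul_self_sqrt hp).symm
        _ ≤ _ := by gcongr
    · positivity
  refine (sum_le_sum fun g _ => key g).trans ?_
  rw [sum_array_prod (fun t j b => √(bernoulliMass (P t j) b) * √(bernoulliMass (Q t j) b)),
    Finset.sum_div, ← Finset.sum_neg_distrib, Real.exp_sum]
  refine prod_le_prod (fun t _ => prod_nonneg fun j _ => by positivity) fun t _ => ?_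
  rw [Finset.sum_div, ← Finset.sum_neg_distrib, Real.exp_sum]
  refine prod_le_prod (fun j _ => by positivity) fun j _ => ?_
  simpa [bernoulliMass] using bernoulli_affinity_le (hP0 t j) (hP1 t j) (hQ0 t j) (hQ1 t j)

/-- A Chernoff bound for the number of memberships in the cells of `S`. -/
lemma sum_arrayMass_le_of_count {T n : ℕ} {P : Fin T → Fin n → ℝ}
    (hP0 : ∀ t j, 0 ≤ P t j) (hP1 : ∀ t j, P t j ≤ 1) (S : Fin T → Finset (Fin n)) (x : ℝ) :
    ∑ g, (if x ≤ ∑ t, ∑ j ∈ S t, ind (g t j) then arrayMass P g else 0)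
      ≤ Real.exp (2 * (∑ t, ∑ j ∈ S t, P t j) - x) := by
  -- Exponential Markov inequality with parameter 1.
  have key : ∀ g, (if x ≤ ∑ t, ∑ j ∈ S t, ind (g t j) then arrayMass P g else 0)
      ≤ Real.exp (-x) * ∏ t, ∏ j, (bernoulliMass (P t j) (g t j) *
          Real.exp (if j ∈ S t then ind (g t j) else 0)) := by
    intro g
    have hp := arrayMass_nonneg hP0 hP1 g
    have e : ∏ t, ∏ j, (bernoulliMass (P t j) (g t j) *
          Real.exp (if j ∈ S t then ind (g t j) else 0))
        = arrayMass P g * Real.exp (∑ t, ∑ j ∈ S t, ind (g t j)) := by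
      simp only [prod_mul_distrib, arrayMass, ← Real.exp_sum, Finset.sum_ite_mem, univ_inter]
    rw [e]
    split_ifs with h
    · rw [mul_left_comm, ← Real.exp_add]
      exact le_mul_of_one_le_right hp (Real.one_le_exp (by linarith))
    · positivity
  refine (sum_le_sum fun g _ => key g).trans ?_
  rw [← mul_sum, sum_array_prod (fun t j b => bernoulliMass (P t j) b *
          Real.exp (if j ∈ S t then ind b else 0)), sub_eq_neg_add, Real.exp_add]
  refine mul_le_mul_of_nonneg_left ?_ (Real.exp_nonneg _)
  have h0 : ∀ t j b, 0 ≤ bernoulliMass (P t j) b * Real.exp (if j ∈ S t then ind b else 0) :=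
    fun t j b => mul_nonneg (bernoulliMass_nonneg (hP0 t j) (hP1 t j) _) (Real.exp_nonneg _)
  rw [mul_sum, Real.exp_sum]
  refine prod_le_prod (fun t _ => prod_nonneg fun j _ => add_nonneg (h0 _ _ _) (h0 _ _ _))
    fun t _ => ?_
  rw [mul_sum, ← univ_inter (S t), ← Finset.sum_ite_mem, Real.exp_sum]
  simp only [univ_inter]
  refine prod_le_prod (fun j _ => add_nonneg (h0 _ _ _) (h0 _ _ _)) fun j _ => ?_
  by_cases hj : j ∈ S t
  · simp only [hj, if_true, bernoulliMass, ind]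
    -- The moment generating function at 1 is 1 + (e - 1)p ≤ 1 + 2p ≤ exp(2p), because e < 3.
    have h := Real.add_one_le_exp (2 * P t j)
    have h3 := Real.exp_one_lt_three
    have := hP0 t j
    simp
    nlinarith
  · simp [hj, bernoulliMass]

/-! ### Fitted parameters and the profile likelihood -/

lemma hubCount_cast {nL T : ℕ} (z : Fin T → Fin nL) (i : Fin nL) :
    (hubCount z i : ℝ) = ∑ t, if z t = i then (1 : ℝ) else 0 := by
  simp [hubCount]

lemma hatA_eq_div {nL n T : ℕ} (g : Fin T → Fin n → Bool) (z : Fin T → Fin nL)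
    (i : Fin nL) (j : Fin n) :
    hatA g z i j = ((univ.filter fun t => z t = i ∧ g t j = true).card : ℝ) / hubCount z i := by
  unfold hatA
  congr 1
  rw [Finset.card_filter, Nat.cast_sum]
  refine sum_congr rfl fun t _ => ?_
  by_cases h1 : z t = i <;> by_cases h2 : g t j = true <;> simp [h1, h2, ind]

lemma hatA_le_one {nL n T : ℕ} (g : Fin T → Fin n → Bool) (z : Fin T → Fin nL)
    (i : Fin nL) (j : Fin n) : hatA g z i j ≤ 1 := by
  rw [hatA_eq_div]
  refine div_le_one_of_le₀ ?_ (by positivity)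
  unfold hubCount
  exact_mod_cast card_le_card fun t ht => by simp_all

lemma one_sub_hatA {nL n T : ℕ} (g : Fin T → Fin n → Bool) (z : Fin T → Fin nL)
    {i : Fin nL} (hi : hubCount z i ≠ 0) (j : Fin n) :
    1 - hatA g z i j
      = ((univ.filter fun t => z t = i ∧ g t j = false).card : ℝ) / hubCount z i := by
  have hi' : (hubCount z i : ℝ) ≠ 0 := by exact_mod_cast hi
  rw [hatA_eq_div, eq_div_iff hi', sub_mul, div_mul_cancel₀ _ hi', one_mul, sub_eq_iff_eq_add]
  unfold hubCount
  rw [← Nat.cast_add, ← card_union_of_disjoint]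
  · congr 2
    ext t
    cases h : g t j <;> simp [h]
  · rw [disjoint_filter]
    rintro t - ⟨-, h⟩ ⟨-, h'⟩
    simp [h] at h'

lemma hubCount_self_pos {nL T : ℕ} (z : Fin T → Fin nL) (t : Fin T) : 0 < hubCount z (z t) :=
  card_pos.2 ⟨t, by simp⟩

/-- The mass that the fitted parameters give to an entry, as a relative frequency. -/
lemma bernoulliMass_hatA {nL n T : ℕ} (g : Fin T → Fin n → Bool) (z : Fin T → Fin nL)
    {i : Fin nL} (hi : hubCount z i ≠ 0) (j : Fin n) (b : Bool) :
    bernoulliMass (hatA g z i j) b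
      = ((univ.filter fun t => z t = i ∧ g t j = b).card : ℝ) / hubCount z i := by
  cases b
  · simpa [bernoulliMass] using one_sub_hatA g z hi j
  · simpa [bernoulliMass] using hatA_eq_div g z i j

/-- Group `t` is itself counted in the relative frequency of its own entry, so the fitted likelihood
never vanishes and its logarithm splits into a sum. -/
lemma bernoulliMass_hatA_pos {nL n T : ℕ} (g : Fin T → Fin n → Bool) (z : Fin T → Fin nL)
    (t : Fin T) (j : Fin n) : 0 < bernoulliMass (hatA g z (z t) j) (g t j) := by
  have h := hubCount_self_pos z t
  rw [bernoulliMass_hatA g z h.ne']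
  have : 0 < (univ.filter fun t' => z t' = z t ∧ g t' j = g t j).card :=
    card_pos.2 ⟨t, by simp⟩
  positivity

lemma profileLogLik_eq_log {nL n T : ℕ} (g : Fin T → Fin n → Bool) (z : Fin T → Fin nL) :
    profileLogLik g z = Real.log (arrayMass (fun t j => hatA g z (z t) j) g) := by
  unfold profileLogLik arrayMass
  rw [Real.log_prod fun t _ => prod_ne_zero_iff.2 fun j _ => (bernoulliMass_hatA_pos g z t j).ne']
  refine sum_congr rfl fun t _ => ?_
  rw [Real.log_prod fun j _ => (bernoulliMass_hatA_pos g z t j).ne']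
  refine sum_congr rfl fun j _ => ?_
  cases g t j <;> simp [ind, bernoulliMass]

/-- The fitted parameters maximize the likelihood for given labels (Gibbs' inequality). -/
lemma log_arrayMass_le_profileLogLik {nL n T : ℕ} {A : Fin nL → Fin n → ℝ}
    (hA0 : ∀ i j, 0 ≤ A i j) (hA1 : ∀ i j, A i j ≤ 1)
    (g : Fin T → Fin n → Bool) (z : Fin T → Fin nL)
    (hpos : 0 < arrayMass (fun t j => A (z t) j) g) :
    Real.log (arrayMass (fun t j => A (z t) j) g) ≤ profileLogLik g z := by
  have hne : ∀ t j, bernoulliMass (A (z t) j) (g t j) ≠ 0 := fun t j =>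
    prod_ne_zero_iff.1 (prod_ne_zero_iff.1 hpos.ne' t (mem_univ t)) j (mem_univ j)
  have hp : ∀ t j, 0 < bernoulliMass (A (z t) j) (g t j) := fun t j =>
    (bernoulliMass_nonneg (hA0 _ _) (hA1 _ _) _).lt_of_ne' (hne t j)
  have hq := bernoulliMass_hatA_pos g z
  rw [profileLogLik_eq_log]
  unfold arrayMass
  rw [Real.log_prod fun t _ => prod_ne_zero_iff.2 fun j _ => (hne t j),
    Real.log_prod fun t _ => prod_ne_zero_iff.2 fun j _ => (hq t j).ne', ← sub_nonpos,
    ← sum_sub_distrib]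
  -- Entrywise log r ≤ r - 1. The ratios are then summed over groups with the same label `i` and the
  -- same value `b` at node `j`.
  have h1 : ∀ t, Real.log (∏ j, bernoulliMass (A (z t) j) (g t j))
      - Real.log (∏ j, bernoulliMass (hatA g z (z t) j) (g t j))
      ≤ ∑ j, (bernoulliMass (A (z t) j) (g t j) / bernoulliMass (hatA g z (z t) j) (g t j) - 1) := by
    intro t
    rw [Real.log_prod fun j _ => (hne t j), Real.log_prod fun j _ => (hq t j).ne',
      ← sum_sub_distrib]
    refine sum_le_sum fun j _ => ?_
    rw [← Real.log_div (hne t j) (hq t j).ne']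
    exact Real.log_le_sub_one_of_pos (div_pos (hp t j) (hq t j))
  refine (sum_le_sum fun t _ => h1 t).trans ?_
  rw [sum_comm]
  refine sum_nonpos fun j _ => ?_
  rw [← sum_fiberwise (s := univ) (g := z)]
  refine sum_nonpos fun i _ => ?_
  rw [← sum_fiberwise (s := univ.filter fun t => z t = i) (g := fun t => g t j)]
  have h2 : ∀ b, ∑ t ∈ (univ.filter fun t => z t = i).filter (fun t => g t j = b),
      (bernoulliMass (A (z t) j) (g t j) / bernoulliMass (hatA g z (z t) j) (g t j) - 1)
      ≤ hubCount z i * bernoulliMass (A i j) b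
        - ((univ.filter fun t => z t = i ∧ g t j = b).card : ℝ) := by
    intro b
    rw [filter_filter]
    set F := univ.filter fun t => z t = i ∧ g t j = b with hF
    have hc : ∑ t ∈ F, (bernoulliMass (A (z t) j) (g t j)
          / bernoulliMass (hatA g z (z t) j) (g t j) - 1)
        = ∑ t ∈ F, (bernoulliMass (A i j) b / bernoulliMass (hatA g z i j) b - 1) := by
      refine sum_congr rfl fun t ht => ?_
      obtain ⟨-, rfl, rfl⟩ := mem_filter.1 ht
      rfl
    rw [hc, sum_const, nsmul_eq_mul]
    have hb := bernoulliMass_nonneg (hA0 i j) (hA1 i j) b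
    -- A value that is never observed contributes nothing on the left but a nonnegative term on the
    -- right; for observed values equality holds.
    rcases F.eq_empty_or_nonempty with h | ⟨t, ht⟩
    · rw [h]; simp; positivity
    · have hi : hubCount z i ≠ 0 := by
        obtain ⟨-, rfl, -⟩ := mem_filter.1 ht
        exact (hubCount_self_pos z t).ne'
      have hFc : (F.card : ℝ) ≠ 0 := by exact_mod_cast (card_pos.2 ⟨t, ht⟩).ne'
      have hi' : (hubCount z i : ℝ) ≠ 0 := by exact_mod_cast hi
      rw [bernoulliMass_hatA g z hi, ← hF]
      refine le_of_eq ?_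
      field_simp
  refine (sum_le_sum fun b _ => h2 b).trans ?_
  have h3 : (hubCount z i : ℝ) = ((univ.filter fun t => z t = i ∧ g t j = true).card : ℝ)
      + ((univ.filter fun t => z t = i ∧ g t j = false).card : ℝ) := by
    rw [← Nat.cast_add, ← card_union_of_disjoint]
    · unfold hubCount
      congr 2
      ext t
      cases h : g t j <;> simp [h]
    · rw [disjoint_filter]
      rintro t - ⟨-, h⟩ ⟨-, h'⟩
      simp [h] at h'
  rw [Fintype.sum_bool]
  simp only [bernoulliMass]
  simp
  linarith

/-- A labelling with larger profile likelihood than the true one has, with its fitted parameters, a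
larger likelihood than the truth. -/
lemma arrayMass_le_of_profileLogLik_le {nL n T : ℕ} {A : Fin nL → Fin n → ℝ}
    (hA0 : ∀ i j, 0 ≤ A i j) (hA1 : ∀ i j, A i j ≤ 1)
    {g : Fin T → Fin n → Bool} {z₀ z : Fin T → Fin nL}
    (h : profileLogLik g z₀ ≤ profileLogLik g z) :
    arrayMass (fun t j => A (z₀ t) j) g ≤ arrayMass (fun t j => hatA g z (z t) j) g := by
  have hq : 0 < arrayMass (fun t j => hatA g z (z t) j) g :=
    prod_pos fun t _ => prod_pos fun j _ => bernoulliMass_hatA_pos g z t j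
  -- An array of true likelihood zero is treated apart, since `Real.log 0 = 0` would make the
  -- comparison of logarithms meaningless.
  rcases (arrayMass_nonneg (P := fun t j => A (z₀ t) j) (fun _ _ => hA0 _ _)
    (fun _ _ => hA1 _ _) g).eq_or_lt with h0 | h0
  · rw [← h0]; exact hq.le
  · have := (log_arrayMass_le_profileLogLik hA0 hA1 g z₀ h0).trans h
    rw [profileLogLik_eq_log] at this
    exact (Real.log_le_log_iff h0 hq).1 this

/-! ### Nearest rows, relabellings and the conditional error bound -/

/-- If the rows of `A` are well separated, every row of `B` is close to at most one row of `A`. -/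
lemma exists_nearest_row {nL n : ℕ} {A B : Fin nL → Fin n → ℝ} {κ : ℝ}
    (hsep : ∀ i i', i ≠ i' → 4 * κ ≤ ∑ j, (√(A i j) - √(A i' j)) ^ 2) :
    ∃ π : Fin nL → Fin nL, ∀ i' i, i ≠ π i' → κ ≤ ∑ j, (√(A i j) - √(B i' j)) ^ 2 := by
  have : ∀ i', ∃ p : Fin nL, ∀ i, i ≠ p → κ ≤ ∑ j, (√(A i j) - √(B i' j)) ^ 2 := by
    intro i'
    by_cases h : ∃ p, ∑ j, (√(A p j) - √(B i' j)) ^ 2 < κ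
    · obtain ⟨p, hp⟩ := h
      refine ⟨p, fun i hi => ?_⟩
      have h1 := hsep i p hi
      -- By (a - c)² ≤ 2(a - b)² + 2(c - b)², two rows within κ of the same row would be less than
      -- 4κ apart.
      have h2 : ∑ j, (√(A i j) - √(A p j)) ^ 2
          ≤ 2 * ∑ j, (√(A i j) - √(B i' j)) ^ 2 + 2 * ∑ j, (√(A p j) - √(B i' j)) ^ 2 := by
        rw [mul_sum, mul_sum, ← sum_add_distrib]
        refine sum_le_sum fun j _ => ?_
        nlinarith [sq_nonneg (√(A i j) - √(B i' j) + (√(A p j) - √(B i' j)))]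
      linarith
    · push Not at h
      -- No row is close, so any value of `π i'` serves.
      exact ⟨i', fun i _ => h i⟩
  choose π hπ using this
  exact ⟨π, hπ⟩

/-- The cells `(t, i')` in which the label `i'` stands for the different true label `π i'`. -/
def swapCells {nL n T : ℕ} (h : nL ≤ n) (z₀ : Fin T → Fin nL) (π : Fin nL → Fin nL) (t : Fin T) :
    Finset (Fin n) :=
  (univ.filter fun i' => z₀ t = π i' ∧ i' ≠ z₀ t).map (Fin.castLEEmb h)

/-- An error with `z₀ t = π (z t)` has `z t ≠ z₀ t`, and feasibility makes hub `z t` a member of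
group `t`: this membership lies in `swapCells`. -/
lemma numErrors_le {nL n T : ℕ} (h : nL ≤ n) {g : Fin T → Fin n → Bool} {z₀ z : Fin T → Fin nL}
    (hz : Feasible h g z) (π : Fin nL → Fin nL) :
    (numErrors z₀ z : ℝ) ≤ (univ.filter fun t => z₀ t ≠ π (z t)).card
      + ∑ t, ∑ j ∈ swapCells h z₀ π t, ind (g t j) := by
  unfold numErrors
  rw [card_filter, card_filter, Nat.cast_sum, Nat.cast_sum, ← sum_add_distrib]
  refine sum_le_sum fun t _ => ?_
  have h0 : ∀ j, 0 ≤ ind (g t j) := fun j => by unfold ind; split_ifs <;> norm_num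
  have hs : 0 ≤ ∑ j ∈ swapCells h z₀ π t, ind (g t j) := sum_nonneg fun j _ => h0 j
  by_cases h1 : z₀ t = z t
  · simp only [h1, ne_eq, not_true_eq_false, if_false, Nat.cast_zero]
    positivity
  · by_cases h2 : z₀ t = π (z t)
    · have hm : Fin.castLE h (z t) ∈ swapCells h z₀ π t :=
        mem_map.2 ⟨z t, by simpa [h2] using fun h3 => h1 (h2.trans h3.symm), rfl⟩
      have := single_le_sum (f := fun j => ind (g t j)) (fun j _ => h0 j) hm
      have h3 : ind (g t (Fin.castLE h (z t))) = 1 := by rw [hz t]; rfl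
      rw [h3] at this
      rw [if_pos h1, if_neg (not_not.2 h2)]
      push_cast
      linarith
    · simpa [h1, h2] using hs

/-- Each label `i'` meets only the groups of the single hub `π i'`, at most `M` of them. Summing
over `i'` gives the bound even if `π` is not injective. -/
lemma sum_swapCells_le {nL n T : ℕ} (h : nL ≤ n) {A : Fin nL → Fin n → ℝ} {z₀ : Fin T → Fin nL}
    {a M : ℝ} (ha : 0 ≤ a) (hAa : ∀ i i', i ≠ i' → A i (Fin.castLE h i') ≤ a)
    (hM : ∀ i, (hubCount z₀ i : ℝ) ≤ M) (π : Fin nL → Fin nL) :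
    ∑ t, ∑ j ∈ swapCells h z₀ π t, A (z₀ t) j ≤ nL * (M * a) := by
  calc ∑ t, ∑ j ∈ swapCells h z₀ π t, A (z₀ t) j
      ≤ ∑ t, ∑ i', (if z₀ t = π i' then a else 0) := by
        refine sum_le_sum fun t _ => ?_
        rw [swapCells, sum_map, sum_filter]
        refine sum_le_sum fun i' _ => ?_
        by_cases h1 : z₀ t = π i' <;> by_cases h2 : i' = z₀ t
        · rw [if_neg (by tauto)]
          split_ifs
          simp [ha]
        · rw [if_pos ⟨h1, h2⟩, if_pos h1]
          exact hAa _ _ fun h3 => h2 h3.symm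
        · simp [h1]
        · simp [h1]
    _ = ∑ i', (hubCount z₀ (π i') : ℝ) * a := by
        rw [sum_comm]
        refine sum_congr rfl fun i' _ => ?_
        rw [hubCount_cast, sum_mul]
        exact sum_congr rfl fun t _ => by simp
    _ ≤ ∑ _i' : Fin nL, M * a := sum_le_sum fun i' _ => mul_le_mul_of_nonneg_right (hM _) ha
    _ = nL * (M * a) := by simp

/-- Some feasible labelling has at least the profile likelihood of `z₀` and at least `x` errors. -/
def HasBadLabelling {nL n T : ℕ} (h : nL ≤ n) (g : Fin T → Fin n → Bool) (z₀ : Fin T → Fin nL)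
    (x : ℝ) : Prop :=
  ∃ z, Feasible h g z ∧ profileLogLik g z₀ ≤ profileLogLik g z ∧ x ≤ numErrors z₀ z

open Classical in
/-- A finite-sample bound for the probability of a bad labelling, given the hub labels. -/
lemma sum_hasBadLabelling_le {nL n T : ℕ} (h : nL ≤ n) {A : Fin nL → Fin n → ℝ}
    (hA0 : ∀ i j, 0 ≤ A i j) (hA1 : ∀ i j, A i j ≤ 1) {z₀ : Fin T → Fin nL}
    {κ a M x : ℝ} (hκ : 0 ≤ κ) (ha : 0 ≤ a)
    (hAa : ∀ i i', i ≠ i' → A i (Fin.castLE h i') ≤ a)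
    (hM : ∀ i, (hubCount z₀ i : ℝ) ≤ M)
    (hsep : ∀ i i', i ≠ i' → 4 * κ ≤ ∑ j, (√(A i j) - √(A i' j)) ^ 2) :
    ∑ g : Fin T → Fin n → Bool,
        (if HasBadLabelling h g z₀ (2 * x) then arrayMass (fun t j => A (z₀ t) j) g else 0)
      ≤ (nL : ℝ) ^ T * ((T : ℝ) + 1) ^ (nL * n) * Real.exp (-(κ * x / 2))
        + (nL : ℝ) ^ nL * Real.exp (2 * (nL * (M * a)) - x) := by
  -- The index is a labelling with a table of numerators in 0, ..., T, so `B` runs through a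
  -- deterministic finite family containing every fitted matrix. Truncation at 1 keeps the entries
  -- probabilities when a numerator exceeds its count.
  let B : (Fin T → Fin nL) × (Fin nL → Fin n → Fin (T + 1)) → Fin nL → Fin n → ℝ :=
    fun c i j => min 1 (((c.2 i j : ℕ) : ℝ) / hubCount c.1 i)
  choose ρ hρ using fun c => exists_nearest_row (B := B c) hsep
  set P : Fin T → Fin n → ℝ := fun t j => A (z₀ t) j with hP
  have hB0 : ∀ c i j, 0 ≤ B c i j := fun c i j => le_min zero_le_one (by positivity)
  have hB1 : ∀ c i j, B c i j ≤ 1 := fun c i j => min_le_left _ _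
  have hW := fun g => arrayMass_nonneg (P := P) (fun _ _ => hA0 _ _) (fun _ _ => hA1 _ _) g
  let Q : (Fin T → Fin nL) × (Fin nL → Fin n → Fin (T + 1)) → Fin T → Fin n → ℝ :=
    fun c t j => B c (c.1 t) j
  let far : (Fin T → Fin nL) × (Fin nL → Fin n → Fin (T + 1)) → Prop :=
    fun c => x ≤ (univ.filter fun t => z₀ t ≠ ρ c (c.1 t)).card
  -- At least 2x errors force at least x of one of the two kinds. The map `ρ c` depends on the data
  -- through `c`, hence the sum over all `π`.
  have key : ∀ g : Fin T → Fin n → Bool,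
      (if HasBadLabelling h g z₀ (2 * x) then arrayMass P g else 0)
      ≤ (∑ c, if far c then
            (if arrayMass P g ≤ arrayMass (Q c) g then arrayMass P g else 0) else 0)
        + ∑ π : Fin nL → Fin nL,
            (if x ≤ ∑ t, ∑ j ∈ swapCells h z₀ π t, ind (g t j) then arrayMass P g else 0) := by
    intro g
    have n1 : ∀ c, 0 ≤ (if far c then
            (if arrayMass P g ≤ arrayMass (Q c) g then arrayMass P g else 0) else 0) := by
      intro c; have := hW g; split_ifs <;> first | exact this | exact le_rfl
    have n2 : ∀ π : Fin nL → Fin nL, 0 ≤ (if x ≤ ∑ t, ∑ j ∈ swapCells h z₀ π t, ind (g t j) then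
        arrayMass P g else 0) := by
      intro c; have := hW g; split_ifs <;> first | exact this | exact le_rfl
    by_cases hb : HasBadLabelling h g z₀ (2 * x)
    · rw [if_pos hb]
      obtain ⟨z, hz, hL, hx⟩ := hb
      let c : (Fin T → Fin nL) × (Fin nL → Fin n → Fin (T + 1)) :=
        (z, fun i j => ⟨(univ.filter fun t => z t = i ∧ g t j = true).card,
          Nat.lt_succ_of_le ((card_le_univ _).trans (by simp))⟩)
      have hBc : ∀ i j, B c i j = hatA g z i j := by
        intro i j
        have h1 : B c i j = min 1 (hatA g z i j) := by rw [hatA_eq_div]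
        rw [h1, min_eq_right (hatA_le_one g z i j)]
      have hlik : arrayMass P g ≤ arrayMass (Q c) g := by
        have := arrayMass_le_of_profileLogLik_le hA0 hA1 hL
        simpa only [P, Q, hBc] using this
      have herr := numErrors_le h hz (ρ c) (z₀ := z₀)
      by_cases hf : far c
      · have h1 := single_le_sum (fun c _ => n1 c) (mem_univ c)
        rw [if_pos hf, if_pos hlik] at h1
        have h2 := sum_nonneg fun π (_ : π ∈ (univ : Finset (Fin nL → Fin nL))) => n2 π
        linarith
      · have h1 := single_le_sum (fun π _ => n2 π) (mem_univ (ρ c))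
        have hf' : ((univ.filter fun t => z₀ t ≠ ρ c (z t)).card : ℝ) < x := not_le.1 hf
        rw [if_pos (by linarith)] at h1
        have h2 := sum_nonneg fun c (_ : c ∈ (univ : Finset _)) => n1 c
        linarith
    · rw [if_neg hb]
      exact add_nonneg (sum_nonneg fun c _ => n1 c) (sum_nonneg fun π _ => n2 π)
  refine (sum_le_sum fun g _ => key g).trans ?_
  rw [sum_add_distrib, sum_comm, sum_comm (s := univ) (t := (univ : Finset (Fin nL → Fin nL)))]
  refine add_le_add ?_ ?_
  · have b1 : ∀ c, ∑ g, (if far c then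
            (if arrayMass P g ≤ arrayMass (Q c) g then arrayMass P g else 0) else 0)
        ≤ Real.exp (-(κ * x / 2)) := by
      intro c
      by_cases hf : far c
      · simp only [hf, if_true]
        refine (sum_arrayMass_le_of_likelihood_ratio (fun _ _ => hA0 _ _) (fun _ _ => hA1 _ _)
          (fun _ _ => hB0 _ _ _) (fun _ _ => hB1 _ _ _)).trans (Real.exp_le_exp.2 ?_)
        have : κ * x ≤ ∑ t, ∑ j, (√(P t j) - √(Q c t j)) ^ 2 := by
          calc κ * x ≤ κ * (univ.filter fun t => z₀ t ≠ ρ c (c.1 t)).card :=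
                mul_le_mul_of_nonneg_left hf hκ
            _ = ∑ t ∈ univ.filter fun t => z₀ t ≠ ρ c (c.1 t), κ := by
                rw [sum_const, nsmul_eq_mul, mul_comm]
            _ ≤ ∑ t ∈ univ.filter fun t => z₀ t ≠ ρ c (c.1 t),
                  ∑ j, (√(P t j) - √(Q c t j)) ^ 2 :=
                sum_le_sum fun t ht => hρ c (c.1 t) (z₀ t) (mem_filter.1 ht).2
            _ ≤ _ := sum_le_univ_sum_of_nonneg fun t => sum_nonneg fun j _ => sq_nonneg _
        linarith
      · simp only [hf, if_false, sum_const_zero]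
        positivity
    refine (sum_le_sum fun c _ => b1 c).trans (le_of_eq ?_)
    simp [Fintype.card_prod, Fintype.card_pi, pow_mul, pow_right_comm]
  · have b2 : ∀ π : Fin nL → Fin nL, ∑ g, (if x ≤ ∑ t, ∑ j ∈ swapCells h z₀ π t, ind (g t j) then
        arrayMass P g else 0) ≤ Real.exp (2 * (nL * (M * a)) - x) := by
      intro π
      refine (sum_arrayMass_le_of_count (fun _ _ => hA0 _ _) (fun _ _ => hA1 _ _) _ _).trans
        (Real.exp_le_exp.2 ?_)
      have := sum_swapCells_le h ha hAa hM π
      linarith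
    refine (sum_le_sum fun c _ => b2 c).trans (le_of_eq ?_)
    simp [Fintype.card_pi]

/-- Since a - b = (√a - √b)(√a + √b) and √a + √b ≤ 2√m. -/
lemma sq_le_sq_sqrt_sub_sqrt {a b m δ : ℝ} (hδ : 0 ≤ δ) (hb : 0 ≤ b) (hba : b + δ ≤ a)
    (ham : a ≤ m) (hm : 0 < m) : δ ^ 2 / (4 * m) ≤ (√a - √b) ^ 2 := by
  have ha : 0 ≤ a := by linarith
  have h1 : √b ≤ √a := Real.sqrt_le_sqrt (by linarith)
  have h2 : √a ≤ √m := Real.sqrt_le_sqrt ham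
  have h3 : δ ≤ (√a - √b) * (2 * √m) := by
    nlinarith [Real.sq_sqrt ha, Real.sq_sqrt hb]
  rw [div_le_iff₀ (by positivity)]
  calc δ ^ 2 ≤ ((√a - √b) * (2 * √m)) ^ 2 := pow_le_pow_left₀ hδ h3 2
    _ = (√a - √b) ^ 2 * (4 * m) := by rw [mul_pow, mul_pow, Real.sq_sqrt hm.le]; ring

/-! ### From conditional to unconditional probabilities -/

/-- A property of the labels and the data has small probability if it has small conditional
probability given every admissible vector of labels. -/
lemma IsHubModel.measure_le {Ω : Type*} [MeasurableSpace Ω] {μ : Measure Ω}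
    [IsProbabilityMeasure μ] {nL n T : ℕ} {A : Fin nL → Fin n → ℝ}
    {zstar : Ω → Fin T → Fin nL} {G : Ω → Fin T → Fin n → Bool} (hm : IsHubModel μ A zstar G)
    (good : (Fin T → Fin nL) → Prop) (bad : (Fin T → Fin nL) → (Fin T → Fin n → Bool) → Prop)
    [∀ z g, Decidable (bad z g)] {δ : ℝ} (hδ : 0 ≤ δ)
    (hbad : ∀ z, good z → ∑ g, (if bad z g then arrayMass (fun t j => A (z t) j) g else 0) ≤ δ) :
    μ {ω | good (zstar ω) ∧ bad (zstar ω) (G ω)} ≤ ENNReal.ofReal δ := by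
  classical
  rw [← ofReal_measureReal]
  refine ENNReal.ofReal_le_ofReal ?_
  have hsub : {ω | good (zstar ω) ∧ bad (zstar ω) (G ω)}
      ⊆ ⋃ z ∈ univ.filter good, ⋃ g ∈ univ.filter (bad z), {ω | zstar ω = z ∧ G ω = g} := by
    intro ω hω
    simp only [Set.mem_iUnion]
    exact ⟨zstar ω, by simpa using hω.1, G ω, by simpa using hω.2, rfl, rfl⟩
  have htot : ∑ z, μ.real {ω | zstar ω = z} = 1 := by
    have := sum_measureReal_preimage_singleton (μ := μ) (univ : Finset (Fin T → Fin nL))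
      (f := zstar) fun z _ => hm.measurable_zstar (measurableSet_singleton z)
    simpa [Set.preimage, Set.mem_singleton_iff] using this
  calc μ.real {ω | good (zstar ω) ∧ bad (zstar ω) (G ω)}
      ≤ ∑ z ∈ univ.filter good, ∑ g ∈ univ.filter (bad z), μ.real {ω | zstar ω = z ∧ G ω = g} :=
        (measureReal_mono hsub (measure_ne_top _ _)).trans <| (measureReal_biUnion_finset_le _ _).trans <|
          sum_le_sum fun z _ => measureReal_biUnion_finset_le _ _
    _ ≤ ∑ z ∈ univ.filter good, μ.real {ω | zstar ω = z} * δ := by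
        refine sum_le_sum fun z hz => ?_
        simp_rw [hm.law, ← mul_sum]
        refine mul_le_mul_of_nonneg_left ?_ measureReal_nonneg
        rw [sum_filter]
        exact hbad z (mem_filter.1 hz).2
    _ ≤ ∑ z, μ.real {ω | zstar ω = z} * δ :=
        sum_le_univ_sum_of_nonneg fun z => mul_nonneg measureReal_nonneg hδ
    _ = δ := by rw [← sum_mul, htot, one_mul]

/-- The true labelling is almost surely feasible. -/
lemma IsHubModel.ae_feasible {Ω : Type*} [MeasurableSpace Ω] {μ : Measure Ω}
    [IsProbabilityMeasure μ] {nL n T : ℕ} {h : nL ≤ n} {A : Fin nL → Fin n → ℝ}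
    {zstar : Ω → Fin T → Fin nL} {G : Ω → Fin T → Fin n → Bool} (hm : IsHubModel μ A zstar G)
    (hA : IsHubMatrix h A) : ∀ᵐ ω ∂μ, Feasible h (G ω) (zstar ω) := by
  classical
  -- Applied with δ = 0: an infeasible array has a factor 1 - A i i = 0.
  have := hm.measure_le (fun _ => True) (fun z g => ¬ Feasible h g z) le_rfl fun z _ => by
    refine (sum_eq_zero fun g _ => ?_).le
    by_cases hf : Feasible h g z
    · rw [if_neg (not_not.2 hf)]
    · rw [if_pos hf]
      obtain ⟨t, ht⟩ := not_forall.1 hf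
      refine prod_eq_zero (mem_univ t) (prod_eq_zero (mem_univ (Fin.castLE h (z t))) ?_)
      simp [bernoulliMass, hA.hub, ht]
  rw [ae_iff]
  simpa using this

/-! ### Row separation and rates -/

/-- Separating sets of followers are disjoint, hence small on average. -/
lemma separating_card_le_one {nL n : ℕ} {V : Fin nL → Finset (Fin n)} {s : Fin nL → Fin n → ℝ}
    {τ v : ℝ} (hτ : 0 < τ) (hnL : 0 < nL) (hn : 0 < n)
    (hV : ∀ i, v * n / nL ≤ (V i).card)
    (hs : ∀ i i', i ≠ i' → ∀ j ∈ V i, τ ≤ s i j - s i' j) : v ≤ 1 := by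
  have hd : ∀ i ∈ (univ : Finset (Fin nL)), ∀ i' ∈ (univ : Finset (Fin nL)), i ≠ i' →
      Disjoint (V i) (V i') := by
    intro i _ i' _ hne
    rw [disjoint_left]
    intro j hj hj'
    linarith [hs i i' hne j hj, hs i' i hne.symm j hj']
  have h1 : ∑ i, ((V i).card : ℝ) ≤ n := by
    rw [← Nat.cast_sum, ← card_biUnion hd]
    exact_mod_cast (card_le_univ _).trans (by simp)
  have h2 : v * n ≤ n := by
    calc v * n = ∑ _i : Fin nL, v * n / nL := by
          have : (nL : ℝ) ≠ 0 := by exact_mod_cast hnL.ne'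
          simp; field_simp
      _ ≤ ∑ i, ((V i).card : ℝ) := sum_le_sum fun i _ => hV i
      _ ≤ n := h1
  have h3 : (0 : ℝ) < n := by exact_mod_cast hn
  nlinarith

/-- The Hellinger separation of the rows of a hub matrix with separating sets of followers. -/
lemma separation_of_followers {nL n : ℕ} (h : nL ≤ n) {A s : Fin nL → Fin n → ℝ}
    (hA0 : ∀ i j, 0 ≤ A i j) {d smax τ N : ℝ} (hd : 0 < d) (hsmax : 0 < smax) (hτ : 0 < τ)
    (hs : ∀ i j, j ≠ Fin.castLE h i → A i j = s i j * d ∧ s i j ≤ smax)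
    {V : Fin nL → Finset (Fin n)} (hVfol : ∀ i, ∀ j ∈ V i, nL ≤ (j : ℕ))
    (hVcard : ∀ i, N ≤ (V i).card)
    (hsep : ∀ i i', i ≠ i' → ∀ j ∈ V i, τ ≤ s i j - s i' j) (i i' : Fin nL) (hne : i ≠ i') :
    4 * (N * (τ ^ 2 * d / (16 * smax))) ≤ ∑ j, (√(A i j) - √(A i' j)) ^ 2 := by
  have hj : ∀ j ∈ V i, ∀ l : Fin nL, j ≠ Fin.castLE h l := by
    rintro j hj l rfl
    have := hVfol i _ hj
    simp at this
    omega
  calc 4 * (N * (τ ^ 2 * d / (16 * smax))) = N * (τ ^ 2 * d / (4 * smax)) := by ring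
    _ ≤ (V i).card * (τ ^ 2 * d / (4 * smax)) :=
        mul_le_mul_of_nonneg_right (hVcard i) (by positivity)
    _ = ∑ j ∈ V i, τ ^ 2 * d / (4 * smax) := by rw [sum_const, nsmul_eq_mul]
    _ ≤ ∑ j ∈ V i, (√(A i j) - √(A i' j)) ^ 2 := by
        refine sum_le_sum fun j hjV => ?_
        obtain ⟨e1, b1⟩ := hs i j (hj j hjV i)
        obtain ⟨e2, -⟩ := hs i' j (hj j hjV i')
        have h1 := sq_le_sq_sqrt_sub_sqrt (a := A i j) (b := A i' j) (m := smax * d)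
          (δ := τ * d) (by positivity) (hA0 _ _)
          (by rw [e1, e2]; nlinarith [hsep i i' hne j hjV])
          (by rw [e1]; exact mul_le_mul_of_nonneg_right b1 hd.le) (by positivity)
        refine le_trans (le_of_eq ?_) h1
        field_simp
    _ ≤ _ := sum_le_univ_sum_of_nonneg fun j => sq_nonneg _

/-- The finite-sample bound is exponentially small in `T` once the rates are small. -/
lemma failure_bound_le {nL n T : ℕ} {d v c ε K : ℝ} (hnL : 3 ≤ nL) (hn : 0 < n) (hT : 3 ≤ T)
    (hd : 0 < d) (hd1 : d ≤ Real.exp (-1)) (hv : 0 < v) (hv1 : v ≤ 1) (hc : 0 < c) (hε : 0 < ε)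
    (h1 : (nL : ℝ) ^ 2 * Real.log T / (d * T * v) ≤ c / 8)
    (h1' : (nL : ℝ) ^ 2 * Real.log T / (d * T * v) ≤ ε / 8)
    (h2 : (Real.log d) ^ 2 * (nL : ℝ) ^ 2 * Real.log nL / (d * n * v ^ 2) ≤ c / 4)
    (hK : K / nL ≤ ε / 8) :
    (nL : ℝ) ^ T * ((T : ℝ) + 1) ^ (nL * n) * Real.exp (-(c * (T * v * n * d / nL)))
        + (nL : ℝ) ^ nL * Real.exp (T * (K / nL) - ε * T / 2)
      ≤ Real.exp (-(T : ℝ)) + Real.exp (-(ε / 4 * T)) := by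
  have nL3 : (3 : ℝ) ≤ nL := by exact_mod_cast hnL
  have T3 : (3 : ℝ) ≤ T := by exact_mod_cast hT
  have n0 : (0 : ℝ) < n := by exact_mod_cast hn
  have nL0 : (0 : ℝ) < nL := by linarith
  have T0 : (0 : ℝ) < T := by linarith
  have log_ge : ∀ y : ℝ, 3 ≤ y → 1 ≤ Real.log y := fun y hy => by
    rw [Real.le_log_iff_exp_le (by linarith)]
    linarith [Real.exp_one_lt_three]
  have lnL := log_ge _ nL3
  have lT := log_ge _ T3
  have ld : 1 ≤ (Real.log d) ^ 2 := by
    have : Real.log d ≤ -1 := by rwa [Real.log_le_iff_le_exp hd]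
    nlinarith
  have d1 : d ≤ 1 := hd1.trans (Real.exp_le_one_iff.2 (by norm_num))
  rw [div_le_iff₀ (by positivity)] at h1 h1' h2
  have hU0 : 0 < T * v * n * d / nL := by positivity
  set U := T * v * n * d / nL with hU
  -- Entropy of the labellings, absorbed by the second rate through (log d)² ≥ 1 and v² ≤ v.
  have e1 : T * Real.log nL ≤ c / 4 * U := by
    have : nL * Real.log nL ≤ c / 4 * (d * n * v) := by
      calc nL * Real.log nL ≤ (Real.log d) ^ 2 * ((nL : ℝ) ^ 2 * Real.log nL) := by
            have : nL * Real.log nL ≤ (nL : ℝ) ^ 2 * Real.log nL := by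
              apply mul_le_mul_of_nonneg_right _ (by linarith); nlinarith
            exact this.trans (le_mul_of_one_le_left (by positivity) ld)
        _ ≤ c / 4 * (d * n * v ^ 2) := by linarith
        _ ≤ c / 4 * (d * n * v) := by
            have : v ^ 2 ≤ v := by nlinarith
            gcongr
    calc T * Real.log nL = T / nL * (nL * Real.log nL) := by field_simp
      _ ≤ T / nL * (c / 4 * (d * n * v)) := by gcongr
      _ = c / 4 * U := by rw [hU]; ring
  -- Entropy of the numerator tables, absorbed by the first rate; T + 1 ≤ T² as T ≥ 3.
  have e2 : nL * n * Real.log (T + 1) ≤ c / 4 * U := by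
    have : Real.log ((T : ℝ) + 1) ≤ 2 * Real.log T := by
      rw [← Real.log_rpow T0]
      refine Real.log_le_log (by linarith) ?_
      norm_num
      nlinarith
    calc nL * n * Real.log (T + 1) ≤ nL * n * (2 * Real.log T) := by gcongr
      _ = 2 * n / nL * ((nL : ℝ) ^ 2 * Real.log T) := by field_simp
      _ ≤ 2 * n / nL * (c / 8 * (d * T * v)) := by gcongr
      _ = c / 4 * U := by rw [hU]; ring
  -- Entropy of the maps `π`, again absorbed by the first rate.
  have e3 : nL * Real.log nL ≤ ε / 8 * T := by
    calc nL * Real.log nL ≤ nL * nL := by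
          gcongr; exact (Real.log_le_sub_one_of_pos nL0).trans (by linarith)
      _ ≤ (nL : ℝ) ^ 2 * Real.log T := by nlinarith
      _ ≤ ε / 8 * (d * T * v) := h1'
      _ ≤ ε / 8 * (1 * T * 1) := by gcongr
      _ = ε / 8 * T := by ring
  refine add_le_add ?_ ?_
  · have p1 : (nL : ℝ) ^ T = Real.exp (T * Real.log nL) := by
      rw [mul_comm, Real.exp_mul, Real.exp_log nL0, Real.rpow_natCast]
    have p2 : ((T : ℝ) + 1) ^ (nL * n) = Real.exp (nL * n * Real.log (T + 1)) := by
      rw [mul_comm _ (Real.log _), Real.exp_mul, Real.exp_log (by linarith), ← Nat.cast_mul,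
        Real.rpow_natCast]
    rw [p1, p2, ← Real.exp_add, ← Real.exp_add, Real.exp_le_exp]
    -- By `e1` and `e2` the exponent is at most -cU/2, and `e1` with log nL ≥ 1 gives T ≤ cU/4.
    nlinarith
  · have p1 : (nL : ℝ) ^ nL = Real.exp (nL * Real.log nL) := by
      rw [mul_comm, Real.exp_mul, Real.exp_log nL0, Real.rpow_natCast]
    rw [p1, ← Real.exp_add, Real.exp_le_exp]
    nlinarith

end HubModel

/-! ### The limit theorem -/

theorem theorem3
    -- sizes of the hub set, of the node set, and number of groups
    (nL n T : ℕ → ℕ) (hle : ∀ k, nL k ≤ n k)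
    (hnL : Filter.Tendsto nL Filter.atTop Filter.atTop)
    (hn : Filter.Tendsto n Filter.atTop Filter.atTop)
    (hT : Filter.Tendsto T Filter.atTop Filter.atTop)
    -- the asymmetric hub model
    {Ω : ℕ → Type*} [∀ k, MeasurableSpace (Ω k)]
    (μ : ∀ k, MeasureTheory.Measure (Ω k)) [∀ k, MeasureTheory.IsProbabilityMeasure (μ k)]
    (A : ∀ k, Fin (nL k) → Fin (n k) → ℝ)
    (hA : ∀ k, HubModel.IsHubMatrix (hle k) (A k))
    (zstar : ∀ k, Ω k → Fin (T k) → Fin (nL k))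
    (G : ∀ k, Ω k → Fin (T k) → Fin (n k) → Bool)
    (hmodel : ∀ k, HubModel.IsHubModel (μ k) (A k) (zstar k) (G k))
    -- H1: balanced hub counts, with probability tending to one
    (cmin cmax : ℝ) (hcmin : 0 < cmin)
    (H1 : Filter.Tendsto
      (fun k => μ k {ω | ∀ i : Fin (nL k),
        (T k : ℝ) * cmin / (nL k : ℝ) ≤ (HubModel.hubCount (zstar k ω) i : ℝ) ∧
        (HubModel.hubCount (zstar k ω) i : ℝ) ≤ (T k : ℝ) * cmax / (nL k : ℝ)})
      Filter.atTop (nhds 1))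
    -- H2: sparsity
    (d : ℕ → ℝ) (hd : ∀ k, 0 < d k) (hd0 : Filter.Tendsto d Filter.atTop (nhds 0))
    (s : ∀ k, Fin (nL k) → Fin (n k) → ℝ)
    (smin smax : ℝ) (hsmin : 0 < smin)
    (H2 : ∀ k (i : Fin (nL k)) (j : Fin (n k)), j ≠ Fin.castLE (hle k) i →
      A k i j = s k i j * d k ∧ smin ≤ s k i j ∧ s k i j ≤ smax)
    -- H3: separating sets of followers
    (v : ℕ → ℝ) (hv : ∀ k, 0 < v k)
    (V : ∀ k, Fin (nL k) → Finset (Fin (n k)))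
    (hVfol : ∀ k i, ∀ j ∈ V k i, nL k ≤ (j : ℕ))
    (hVcard : ∀ k i, v k * (n k : ℝ) / (nL k : ℝ) ≤ ((V k i).card : ℝ))
    (τ : ℝ) (hτ : 0 < τ)
    (H3 : ∀ k (i i' : Fin (nL k)), i ≠ i' → ∀ j ∈ V k i, τ ≤ s k i j - s k i' j)
    -- H4: hubs rarely join the groups of other hubs
    (c0 : ℝ) (hc0 : 0 < c0)
    (H4 : ∀ k (i i' : Fin (nL k)), i ≠ i' →
      A k i (Fin.castLE (hle k) i') ≤ c0 / (nL k : ℝ))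
    -- rate conditions
    (hrate1 : Filter.Tendsto
      (fun k => (nL k : ℝ) ^ 2 * Real.log (T k : ℝ) / (d k * (T k : ℝ) * v k))
      Filter.atTop (nhds 0))
    (hrate2 : Filter.Tendsto
      (fun k => (Real.log (d k)) ^ 2 * (nL k : ℝ) ^ 2 * Real.log (nL k : ℝ)
        / (d k * (n k : ℝ) * (v k) ^ 2))
      Filter.atTop (nhds 0))
    (hrate3 : Filter.Tendsto
      (fun k => (Real.log (T k : ℝ)) ^ 2 * (nL k : ℝ) ^ 2 * Real.log (nL k : ℝ)
        / (d k * (n k : ℝ) * (v k) ^ 2))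
      Filter.atTop (nhds 0))
    -- the maximum profile likelihood estimator (any maximizer)
    (zhat : ∀ k, Ω k → Fin (T k) → Fin (nL k))
    (hzhat : ∀ k, ∀ᵐ ω ∂(μ k), HubModel.IsMaxProfileLik (hle k) (G k ω) (zhat k ω)) :
    HubModel.IsLittleOp μ
      (fun k ω => (HubModel.numErrors (zstar k ω) (zhat k ω) : ℝ) / (T k : ℝ)) := by
  
  classical
  intro ε hε
  -- Supplies a positive upper bound on the `s` entries without discussing the sign of `smax`.
  set S := max smax 1 with hS
  have hS0 : 0 < S := lt_max_of_lt_right one_pos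
  -- With κ = (vn/nL) τ² d/(16S) and x = εT/2, the exponent κx/2 equals c T v n d/nL.
  set c := ε * τ ^ 2 / (64 * S) with hc
  have hc0' : 0 < c := by positivity
  set E : ∀ k, Set (Ω k) := fun k => {ω | ∀ i : Fin (nL k),
        (T k : ℝ) * cmin / (nL k : ℝ) ≤ (HubModel.hubCount (zstar k ω) i : ℝ) ∧
        (HubModel.hubCount (zstar k ω) i : ℝ) ≤ (T k : ℝ) * cmax / (nL k : ℝ)} with hE
  have hEm : ∀ k, MeasurableSet (E k) := fun k =>
    (hmodel k).measurable_zstar (Set.toFinite {z | ∀ i : Fin (nL k),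
        (T k : ℝ) * cmin / (nL k : ℝ) ≤ (HubModel.hubCount z i : ℝ) ∧
        (HubModel.hubCount z i : ℝ) ≤ (T k : ℝ) * cmax / (nL k : ℝ)}).measurableSet
  have hTr : Filter.Tendsto (fun k => (T k : ℝ)) Filter.atTop Filter.atTop :=
    tendsto_natCast_atTop_atTop.comp hT
  have hnLr : Filter.Tendsto (fun k => (nL k : ℝ)) Filter.atTop Filter.atTop :=
    tendsto_natCast_atTop_atTop.comp hnL
  have hdecay : ∀ b : ℝ, 0 < b →
      Filter.Tendsto (fun k => Real.exp (-(b * T k))) Filter.atTop (nhds 0) := fun b hb =>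
    Real.tendsto_exp_neg_atTop_nhds_zero.comp (hTr.const_mul_atTop hb)
  have hlim : Filter.Tendsto (fun k => (1 - μ k (E k)) +
      ENNReal.ofReal (Real.exp (-(T k : ℝ)) + Real.exp (-(ε / 4 * T k)))) Filter.atTop
      (nhds 0) := by
    have l1 : Filter.Tendsto (fun k => 1 - μ k (E k)) Filter.atTop (nhds 0) := by
      have := ENNReal.Tendsto.sub (tendsto_const_nhds (x := (1 : ENNReal))) H1
        (Or.inl ENNReal.one_ne_top)
      simpa using this
    have l2 := ENNReal.tendsto_ofReal ((hdecay 1 one_pos).add (hdecay (ε / 4) (by positivity)))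
    simpa using l1.add l2
  refine tendsto_of_tendsto_of_tendsto_of_le_of_le' tendsto_const_nhds hlim
    (Filter.Eventually.of_forall fun k => zero_le) ?_
  -- With M = T cmax/nL and a = c0/nL, the Chernoff term 2 nL M a equals T (2 cmax c0)/nL.
  have hK : Filter.Tendsto (fun k => 2 * cmax * c0 / (nL k : ℝ)) Filter.atTop (nhds 0) :=
    hnLr.const_div_atTop _
  filter_upwards [hnL.eventually_ge_atTop 3, hT.eventually_ge_atTop 3,
    hn.eventually_ge_atTop 1, hd0.eventually_le_const (Real.exp_pos (-1)),
    hrate1.eventually_le_const (show 0 < c / 8 by positivity),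
    hrate1.eventually_le_const (show 0 < ε / 8 by positivity),
    hrate2.eventually_le_const (show 0 < c / 4 by positivity),
    hK.eventually_le_const (show 0 < ε / 8 by positivity)] with k k1 k2 k3 k4 k5 k6 k7 k8
  have hT0 : (0 : ℝ) < T k := by exact_mod_cast (by omega : 0 < T k)
  have hnL0 : (0 : ℝ) < nL k := by exact_mod_cast (by omega : 0 < nL k)
  have hv1 : v k ≤ 1 := HubModel.separating_card_le_one hτ (by omega) (by omega) (hVcard k) (H3 k)
  have hsep := HubModel.separation_of_followers (hle k) (hA k).nonneg (hd k) hS0 hτ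
    (fun i j hj => ⟨(H2 k i j hj).1, (H2 k i j hj).2.2.trans (le_max_left _ _)⟩)
    (hVfol k) (hVcard k) (H3 k)
  have hbound := (hmodel k).measure_le
    (fun z => ∀ i, (HubModel.hubCount z i : ℝ) ≤ T k * cmax / nL k)
    (fun z g => HubModel.HasBadLabelling (hle k) g z (2 * (ε * T k / 2)))
    (δ := Real.exp (-(T k : ℝ)) + Real.exp (-(ε / 4 * T k))) (by positivity) fun z hz => by
      refine (HubModel.sum_hasBadLabelling_le (hle k) (hA k).nonneg (hA k).le_one
        (by have := hd k; have := hv k; positivity) (by positivity) (H4 k) hz hsep).trans ?_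
      refine le_trans (le_of_eq ?_) (HubModel.failure_bound_le k1 (by omega) k2 (hd k) k4 (hv k)
        hv1 hc0' hε k5 k6 k7 k8)
      congr 3
      · rw [hc]; field_simp; ring
      · congr 1; field_simp
  -- Off two null sets the true labelling is feasible, so the maximizer `zhat` itself witnesses
  -- `HasBadLabelling`.
  have hsub : {ω | ε ≤ |(HubModel.numErrors (zstar k ω) (zhat k ω) : ℝ) / (T k : ℝ)|} ⊆
      ((E k)ᶜ ∪ {ω | (∀ i, (HubModel.hubCount (zstar k ω) i : ℝ) ≤ T k * cmax / nL k) ∧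
        HubModel.HasBadLabelling (hle k) (G k ω) (zstar k ω) (2 * (ε * T k / 2))}) ∪
      ({ω | ¬ HubModel.IsMaxProfileLik (hle k) (G k ω) (zhat k ω)} ∪
        {ω | ¬ HubModel.Feasible (hle k) (G k ω) (zstar k ω)}) := by
    intro ω hω
    by_contra hcon
    simp only [Set.mem_union, Set.mem_compl_iff, Set.mem_ofPred_eq, not_or, not_not] at hcon
    obtain ⟨⟨hωE, hgood⟩, hmax, hfeas⟩ := hcon
    refine hgood ⟨fun i => (hωE i).2, zhat k ω, hmax.1, hmax.2 _ hfeas, ?_⟩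
    have hω' : ε ≤ |(HubModel.numErrors (zstar k ω) (zhat k ω) : ℝ) / (T k : ℝ)| := hω
    rw [abs_of_nonneg (by positivity), le_div_iff₀ hT0] at hω'
    linarith
  have hnull : μ k ({ω | ¬ HubModel.IsMaxProfileLik (hle k) (G k ω) (zhat k ω)} ∪
        {ω | ¬ HubModel.Feasible (hle k) (G k ω) (zstar k ω)}) = 0 :=
    MeasureTheory.measure_union_null (MeasureTheory.ae_iff.1 (hzhat k))
      (MeasureTheory.ae_iff.1 ((hmodel k).ae_feasible (hA k)))
  calc _ ≤ _ := MeasureTheory.measure_mono hsub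
    _ ≤ _ := MeasureTheory.measure_union_le _ _
    _ ≤ _ := by
      rw [hnull, add_zero]
      refine (MeasureTheory.measure_union_le _ _).trans (add_le_add ?_ hbound)
      rw [MeasureTheory.prob_compl_eq_one_sub (hEm k)]
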